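/- Conventions. A fan in $\mathbb{R}^3$ is a nonempty finite collection of polyhedral cones, closed under taking faces, any two of which intersect in a common face of both; its rays are its one-dimensional cones. It is complete if its cones cover $\mathbb{R}^3$. It is unimodular if every cone lies in a three-dimensional cone of the fan and every cone is generated by linearly independent primitive integer vectors that generate the lattice of all integer points in the linear span of the cone. It is polytopal if it is the collection of the normal cones of all faces of some polytope. A fan $\Sigma$ refines a fan $\Sigma'$ if every cone of $\Sigma$ is contained in some cone of $\Sigma'$; the refinement is proper if moreover $\Sigma\neq\Sigma'$. Theorem. For every integer $k\ge 0$ there is a complete unimodular polytopal fan in $\mathbb{R}^3$ with exactly $k+6$ rays that is not a proper refinement of any unimodular fan. Consequently, there is no $N$ such that every complete unimodular polytopal fan in $\mathbb{R}^3$ refines a unimodular fan with at most $N$ rays. -/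

import Mathlib

/-! Polyhedral fans in `ℝⁿ = Fin n → ℝ`; the dual space is identified with `ℝⁿ` through the
standard scalar product `⬝ᵥ`. -/

/-- A polyhedral fan in `ℝⁿ`: a nonempty finite collection of polyhedral (that is, finitely
generated) cones, closed under taking faces, such that any two of its cones intersect in a common
face of both. -/
@[ext]
structure PolyhedralFan (n : ℕ) where
  cones : Set (PointedCone ℝ (Fin n → ℝ))
  nonempty : cones.Nonempty
  finite : cones.Finite
  polyhedral : ∀ C ∈ cones, C.FG
  face_mem : ∀ C ∈ cones, ∀ F : PointedCone ℝ (Fin n → ℝ), F.IsFaceOf C → F ∈ cones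
  inter_face : ∀ C ∈ cones, ∀ D ∈ cones, (C ⊓ D).IsFaceOf C ∧ (C ⊓ D).IsFaceOf D

namespace PolyhedralFan

/-- The dimension of a cone: the dimension of its linear span. -/
noncomputable def coneDim {n : ℕ} (C : PointedCone ℝ (Fin n → ℝ)) : ℕ :=
  Module.finrank ℝ (Submodule.span ℝ (C : Set (Fin n → ℝ)))

/-- The rays of a fan: its one-dimensional cones. -/
def rays {n : ℕ} (𝒩 : PolyhedralFan n) : Set (PointedCone ℝ (Fin n → ℝ)) :=
  {C ∈ 𝒩.cones | coneDim C = 1}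

/-- A fan is complete if its cones cover the whole space. -/
def IsComplete {n : ℕ} (𝒩 : PolyhedralFan n) : Prop :=
  ∀ x : Fin n → ℝ, ∃ C ∈ 𝒩.cones, x ∈ C

/-! ### Unimodular fans -/

/-- The lattice `ℤⁿ` inside `ℝⁿ`. -/
def intLattice (n : ℕ) : AddSubgroup (Fin n → ℝ) :=
  ((Int.castAddHom ℝ).compLeft (Fin n)).range

/-- A primitive vector: an integer vector with relatively prime entries. -/
def IsPrimitive {n : ℕ} (v : Fin n → ℝ) : Prop :=
  ∃ z : Fin n → ℤ, Finset.univ.gcd z = 1 ∧ ∀ i, v i = (z i : ℝ)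

/-- `C` is a rational simplicial cone whose primitive ray generators are the elements of `s`. -/
structure IsPrimitiveGeneratingSet {n : ℕ} (s : Set (Fin n → ℝ))
    (C : PointedCone ℝ (Fin n → ℝ)) : Prop where
  finite : s.Finite
  primitive : ∀ v ∈ s, IsPrimitive v
  linearIndepOn : LinearIndepOn ℝ id s
  hull_eq : PointedCone.hull ℝ s = C

/-- The index of the lattice generated by `s` in the lattice `span ℝ s ∩ ℤⁿ`. If `s` is the set of
primitive ray generators of a rational simplicial cone, this is the multiplicity of that cone. -/
noncomputable def coneMultiplicity {n : ℕ} (s : Set (Fin n → ℝ)) : ℕ :=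
  (AddSubgroup.closure s).relIndex (intLattice n ⊓ (Submodule.span ℝ s).toAddSubgroup)

/-- A unimodular cone: a rational simplicial cone of multiplicity one. -/
def IsUnimodularCone {n : ℕ} (C : PointedCone ℝ (Fin n → ℝ)) : Prop :=
  ∃ s : Set (Fin n → ℝ), IsPrimitiveGeneratingSet s C ∧ coneMultiplicity s = 1

/-- A unimodular fan: a full-dimensional rational simplicial fan all of whose cones have
multiplicity one. -/
structure IsUnimodular {n : ℕ} (𝒩 : PolyhedralFan n) : Prop where
  unimodularCone : ∀ C ∈ 𝒩.cones, IsUnimodularCone C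
  fullDimensional : ∀ C ∈ 𝒩.cones, ∃ D ∈ 𝒩.cones, C ≤ D ∧ coneDim D = n

/-! ### Polytopal fans -/

/-- The face of `P` in the direction of `a`: the set of points of `P` at which the linear
functional `a` attains its maximum over `P`. -/
def faceInDirection {n : ℕ} (P : Set (Fin n → ℝ)) (a : Fin n → ℝ) : Set (Fin n → ℝ) :=
  {p ∈ P | ∀ x ∈ P, 0 ≤ a ⬝ᵥ (p - x)}

/-- The normal cone of a face `F` of `P`. -/
def normalCone {n : ℕ} (P F : Set (Fin n → ℝ)) : PointedCone ℝ (Fin n → ℝ) where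
  carrier := {a | ∀ p ∈ F, ∀ q ∈ P, 0 ≤ a ⬝ᵥ (p - q)}
  add_mem' := by
    intro a b ha hb p hp q hq
    rw [add_dotProduct]
    exact add_nonneg (ha p hp q hq) (hb p hp q hq)
  zero_mem' := by
    intro p _ q _
    simp
  smul_mem' := by
    intro c a ha p hp q hq
    have h : (c • a) ⬝ᵥ (p - q) = (c : ℝ) * (a ⬝ᵥ (p - q)) := smul_dotProduct (c : ℝ) a (p - q)
    rw [h]
    exact mul_nonneg c.2 (ha p hp q hq)

/-- The normal cones of all faces of `P`. -/
def normalFanCones {n : ℕ} (P : Set (Fin n → ℝ)) : Set (PointedCone ℝ (Fin n → ℝ)) :=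
  {N | ∃ a : Fin n → ℝ, N = normalCone P (faceInDirection P a)}

/-- A fan is polytopal if it is the normal fan of a (nonempty) polytope, that is, of the convex
hull of a nonempty finite set of points. -/
def IsPolytopal {n : ℕ} (𝒩 : PolyhedralFan n) : Prop :=
  ∃ S : Finset (Fin n → ℝ), S.Nonempty ∧
    𝒩.cones = normalFanCones (convexHull ℝ (S : Set (Fin n → ℝ)))

/-! ### Refinement -/

/-- `𝒩` refines `𝒩'`: every cone of `𝒩` is contained in some cone of `𝒩'`. (If `𝒩` is complete,
this forces `𝒩'` to be complete.) -/
def Refines {n : ℕ} (𝒩 𝒩' : PolyhedralFan n) : Prop :=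
  ∀ C ∈ 𝒩.cones, ∃ D ∈ 𝒩'.cones, C ≤ D

/-- `𝒩` is a proper refinement of `𝒩'`. -/
def ProperlyRefines {n : ℕ} (𝒩 𝒩' : PolyhedralFan n) : Prop :=
  𝒩.Refines 𝒩' ∧ 𝒩 ≠ 𝒩'

end PolyhedralFan

/-! The rays of the fan are spanned by `(1, l, l²)` for the slopes `l = 0, …, k`, by `(0, ±1, 0)`
and `(-1, 0, 0)`, and by the poles `(0, 0, ±1)`; a maximal cone joins a pole to two consecutive
other rays. A strictly convex height function that is linear on the maximal cones exhibits the fan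
as the normal fan of the convex hull of its linear pieces.

Suppose the fan refines a fan without lines in its cones, and some ray `ℝ₊ v` is not a cone of that
fan. Then `v` is a nonnegative combination of other generators, all of them in every coarse cone
through `v`. If `v` lies in common cells with both `w` and `-w`, then `w` is outside the linear
span of this combination, as otherwise a coarse cone would contain a line. Hence `±w` do not occur
in it, and looking at signs of coordinates excludes `v` being a pole or one of the horizontal
generators. For `v = (1, m, m²)` take for `w` the vertical axis: all terms lie in a plane through
`v` without this axis, which meets the parabola in at most one further point `(1, r, r²)`, and
comparing coordinates gives `r = m`. So every ray survives, and if the coarse fan is simplicial, the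
two fans agree. -/

open PointedCone Function

section Cone

variable {𝕜 ι E : Type*} [Field 𝕜] [LinearOrder 𝕜] [IsStrictOrderedRing 𝕜]
  [AddCommGroup E] [Module 𝕜 E]

theorem mem_hull_image_iff [Fintype ι] {v : ι → E} {K : Set ι} {x : E} :
    x ∈ hull 𝕜 (v '' K) ↔ ∃ c : ι → 𝕜, 0 ≤ c ∧ support c ⊆ K ∧ ∑ i, c i • v i = x := by
  constructor
  · intro hx
    obtain ⟨l, hl, rfl⟩ := (Finsupp.mem_span_image_iff_linearCombination _).1 hx
    refine ⟨fun i => l i, fun i => (l i).2, fun i hi => hl ?_, ?_⟩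
    · exact Finsupp.mem_support_iff.2 fun h => hi (congrArg Subtype.val h)
    · rw [Finsupp.linearCombination_apply, Finsupp.sum_fintype _ _ (by simp)]
      rfl
  · rintro ⟨c, hc, hK, rfl⟩
    refine Submodule.sum_mem _ fun i _ => ?_
    by_cases hi : c i = 0
    · simp [hi]
    · exact (hull 𝕜 (v '' K)).smul_mem (hc i) (subset_hull ⟨i, hK hi, rfl⟩)

theorem span_hull (s : Set E) : Submodule.span 𝕜 (hull 𝕜 s : Set E) = Submodule.span 𝕜 s :=
  le_antisymm (Submodule.span_le.2 (hull_le_span (R := 𝕜) s)) (Submodule.span_mono subset_hull)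

theorem mem_hull_inter_of_isFaceOf {C F : PointedCone 𝕜 E} (hF : F.IsFaceOf C) {s : Set E}
    (hs : s ⊆ C) {x : E} (hx : x ∈ hull 𝕜 s) (hxF : x ∈ F) : x ∈ hull 𝕜 (s ∩ F) := by
  have hsC : hull 𝕜 s ≤ C := Submodule.span_le.2 hs
  induction hx using Submodule.span_induction with
  | mem x hx => exact subset_hull ⟨hx, hxF⟩
  | zero => exact zero_mem _
  | add x y hx hy ihx ihy =>
    obtain ⟨hxF, hyF⟩ := (hF.add_mem_iff_mem (hsC hx) (hsC hy)).1 hxF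
    exact add_mem (ihx hxF) (ihy hyF)
  | smul a x hx ih =>
    rcases a.2.eq_or_lt with ha | ha
    · rw [show a = 0 from Subtype.ext ha.symm, zero_smul]
      exact zero_mem _
    · exact Submodule.smul_mem _ a
        (ih (hF.mem_of_smul_add_mem (hsC hx) C.zero_mem ha (by simpa using hxF)))

theorem isFaceOf_hull_of_linearIndepOn {s t : Set E} (ht : LinearIndepOn 𝕜 id t) (hst : s ⊆ t) :
    (hull 𝕜 s).IsFaceOf (hull 𝕜 t) where
  le := Submodule.span_mono hst
  mem_of_smul_add_mem := by
    intro x y a hx hy ha hxy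
    obtain ⟨c, hct, hc, rfl⟩ := mem_hull_set.1 hx
    obtain ⟨d, hdt, hd, rfl⟩ := mem_hull_set.1 hy
    obtain ⟨e, hes, -, he⟩ := mem_hull_set.1 hxy
    have key : e = a • c + d :=
      linearIndepOn_iffₛ.1 ht e (hes.trans hst) _
        (Submodule.add_mem _ (Submodule.smul_mem _ a hct) hdt)
        (by simpa only [map_add, map_smul, Finsupp.linearCombination_apply, id] using he)
    refine mem_hull_set.2 ⟨c, fun v hv => hes ?_, hc, rfl⟩
    have hpos : 0 < c v := lt_of_le_of_ne (hc v) (Ne.symm (Finsupp.mem_support_iff.1 hv))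
    have : 0 < e v := by
      simpa [key] using add_pos_of_pos_of_nonneg (mul_pos ha hpos) (hd v)
    exact Finsupp.mem_support_iff.2 this.ne'

theorem lineal_eq_bot_of_isSimplicial {C : PointedCone 𝕜 E} (hC : C.IsSimplicial) :
    C.lineal = ⊥ := by
  obtain ⟨s, -, hs, rfl⟩ := hC
  refine (Submodule.eq_bot_iff _).2 fun x hx => ?_
  simpa using (isFaceOf_hull_of_linearIndepOn hs (Set.empty_subset s)).lineal_le hx

theorem isFaceOf_hull_singleton {s : Set E} (hs : (hull 𝕜 s).lineal = ⊥) {v : E} (hv : v ∈ s)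
    (hnot : v ∉ hull 𝕜 (s \ {v})) : (hull 𝕜 {v}).IsFaceOf (hull 𝕜 s) where
  le := Submodule.span_mono (Set.singleton_subset_iff.2 hv)
  mem_of_smul_add_mem := by
    intro x y a hx hy ha hxy
    have hdecomp : ∀ z ∈ hull 𝕜 s, ∃ r : 𝕜, 0 ≤ r ∧ ∃ z' ∈ hull 𝕜 (s \ {v}), z = r • v + z' := by
      intro z hz
      rw [← Set.insert_eq_of_mem hv, ← Set.insert_sdiff_singleton] at hz
      obtain ⟨r, z', hz', rfl⟩ := Submodule.mem_span_insert.1 hz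
      exact ⟨r, r.2, z', hz', rfl⟩
    have hle : hull 𝕜 (s \ {v}) ≤ hull 𝕜 s := Submodule.span_mono Set.sdiff_subset
    obtain ⟨α, hα, x', hx', rfl⟩ := hdecomp x hx
    obtain ⟨β, -, y', hy', rfl⟩ := hdecomp y hy
    obtain ⟨q, hq⟩ := Submodule.mem_span_singleton.1 hxy
    have hax' : a • x' ∈ hull 𝕜 (s \ {v}) := smul_mem _ ha.le hx'
    have hsum : ((q : 𝕜) - a * α - β) • v = a • x' + y' := by
      have hq : (q : 𝕜) • v = a • (α • v + x') + (β • v + y') := hq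
      rw [sub_smul, sub_smul, hq]
      module
    rcases lt_or_ge 0 ((q : 𝕜) - a * α - β) with hpos | hneg
    · exact absurd ((smul_mem_iff _ hpos).1 (hsum ▸ add_mem hax' hy')) hnot
    · have hlineal : a • x' ∈ (hull 𝕜 s).lineal := by
        refine mem_lineal.2 ⟨hle hax', ?_⟩
        have : -(a • x') = y' + (-((q : 𝕜) - a * α - β)) • v := by
          rw [neg_smul, hsum]
          abel
        rw [this]
        exact add_mem (hle hy') (smul_mem _ (neg_nonneg.2 hneg) (subset_hull hv))
      have hx'0 : x' = 0 := by simpa [hs, ha.ne'] using hlineal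
      rw [hx'0, add_zero]
      exact smul_mem _ hα (subset_hull rfl)

end Cone

theorem exists_dotProduct_ne_zero_of_notMem {K m : Type*} [Field K] [Fintype m]
    {p : Submodule K (m → K)} {v : m → K} (hv : v ∉ p) :
    ∃ y, v ⬝ᵥ y ≠ 0 ∧ ∀ x ∈ p, x ⬝ᵥ y = 0 := by
  classical
  obtain ⟨φ, hφ, hker⟩ := p.exists_le_ker_of_notMem hv
  have hdot (x : m → K) : φ x = x ⬝ᵥ fun i => φ fun j => if i = j then 1 else 0 :=
    φ.pi_apply_eq_sum_univ x
  exact ⟨_, hdot v ▸ hφ, fun x hx => hdot x ▸ hker hx⟩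

theorem exists_pos_sub_smul_mem_hull {ι E : Type*} [Fintype ι] [AddCommGroup E] [Module ℝ E]
    {v : ι → E} {c : ι → ℝ} (hc : 0 ≤ c) {y : E} (hy : y ∈ Submodule.span ℝ (v '' support c)) :
    ∃ t : ℝ, 0 < t ∧ ∑ i, c i • v i - t • y ∈ hull ℝ (v '' support c) := by
  obtain ⟨d, hd, rfl⟩ := (Finsupp.mem_span_image_iff_linearCombination _).1 hy
  have hev : ∀ᶠ t in nhdsWithin (0 : ℝ) (Set.Ioi 0), ∀ i, t * d i ≤ c i := by
    refine Filter.eventually_all.2 fun i => ?_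
    by_cases hi : c i = 0
    · have : d i = 0 := Finsupp.notMem_support_iff.1 fun h => hd h hi
      simp [hi, this]
    · have hlim : Filter.Tendsto (fun t : ℝ => t * d i) (nhds 0) (nhds (0 * d i)) :=
        (continuous_mul_const (d i)).tendsto 0
      rw [zero_mul] at hlim
      exact nhdsWithin_le_nhds
        ((hlim.eventually_lt_const (lt_of_le_of_ne (hc i) (Ne.symm hi))).mono fun _ => le_of_lt)
  obtain ⟨t, ht, ht0⟩ := (hev.and self_mem_nhdsWithin).exists
  refine ⟨t, ht0, mem_hull_image_iff.2 ⟨fun i => c i - t * d i, fun i => sub_nonneg.2 (ht i),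
    fun i hi => ?_, ?_⟩⟩
  · contrapose! hi
    have hci : c i = 0 := by simpa using hi
    have hdi : d i = 0 := Finsupp.notMem_support_iff.1 fun h => hd h hci
    simp [hci, hdi]
  · simp only [sub_smul, mul_smul, Finset.sum_sub_distrib, ← Finset.smul_sum]
    rw [Finsupp.linearCombination_apply, Finsupp.sum_fintype _ _ (by simp)]

namespace PolyhedralFan

variable {n : ℕ} {𝒩 𝒩' : PolyhedralFan n}

/-- A simplicial fan: every cone is generated by linearly independent vectors. -/
def IsSimplicial (𝒩 : PolyhedralFan n) : Prop :=
  ∀ C ∈ 𝒩.cones, C.IsSimplicial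

/-- A fan is salient (in the toric literature: pointed, or strongly convex) if none of its cones
contains a line. -/
def IsSalient (𝒩 : PolyhedralFan n) : Prop :=
  ∀ C ∈ 𝒩.cones, C.lineal = ⊥

theorem IsUnimodular.isSimplicial (h : 𝒩.IsUnimodular) : 𝒩.IsSimplicial := fun C hC =>
  let ⟨s, hs, _⟩ := h.unimodularCone C hC
  ⟨s, hs.finite, hs.linearIndepOn, hs.hull_eq⟩

theorem IsSimplicial.isSalient (h : 𝒩.IsSimplicial) : 𝒩.IsSalient := fun C hC =>
  lineal_eq_bot_of_isSimplicial (h C hC)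

theorem IsComplete.eq_of_cones_subset (h𝒩 : 𝒩.IsComplete) (hsub : 𝒩.cones ⊆ 𝒩'.cones) :
    𝒩 = 𝒩' := by
  refine PolyhedralFan.ext (hsub.antisymm fun C hC => ?_)
  obtain ⟨s, hs⟩ := 𝒩'.polyhedral C hC
  have hsC : ∀ v : s, v.1 ∈ C := fun v => hs ▸ Submodule.subset_span v.2
  -- The cone of `𝒩` through a relative interior point of `C` contains all of `C`.
  obtain ⟨D, hD, hsD⟩ := h𝒩 (∑ v : s, v.1)
  have hface := (𝒩'.inter_face C hC D (hsub hD)).1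
  have hCD : C ≤ D := hs ▸ Submodule.span_le.2 fun v hv =>
    (hface.mem_of_sum_mem hsC ⟨C.sum_mem fun v _ => hsC v, hsD⟩ ⟨v, hv⟩).2
  exact 𝒩.face_mem D hD C (inf_eq_left.2 hCD ▸ (𝒩'.inter_face C hC D (hsub hD)).2)

end PolyhedralFan

/-- An integer vector, seen in `ℝⁿ`. -/
def intVec {n : ℕ} (z : Fin n → ℤ) : Fin n → ℝ := fun a => (z a : ℝ)

theorem intVec_dotProduct {n : ℕ} (z w : Fin n → ℤ) :
    intVec z ⬝ᵥ intVec w = ((z ⬝ᵥ w : ℤ) : ℝ) := by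
  simp [intVec, dotProduct]

/-- Certificate for a complete unimodular polytopal fan in `ℝⁿ`. The maximal cones are generated by
the cells, each of which is a lattice basis with dual basis `dual`; the integers `height i` are the
values at the generators of a convex function that is linear exactly on the maximal cones. -/
structure ConvexFanData (n : ℕ) (ι κ : Type*) [DecidableEq ι] where
  gen : ι → Fin n → ℤ
  cell : κ → Finset ι
  dual : κ → ι → Fin n → ℤ
  height : ι → ℤ
  card_cell (I : κ) : (cell I).card = n
  exists_mem_cell (i : ι) : ∃ I, i ∈ cell I
  gen_dotProduct_dual {I : κ} {i j : ι} (hi : i ∈ cell I) (hj : j ∈ cell I) :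
    gen i ⬝ᵥ dual I j = if i = j then 1 else 0
  sum_lt_height {I : κ} {j : ι} (hj : j ∉ cell I) :
    ∑ i ∈ cell I, height i * (gen j ⬝ᵥ dual I i) < height j
  cover (x : Fin n → ℝ) : ∃ I, ∀ i ∈ cell I, 0 ≤ x ⬝ᵥ intVec (dual I i)

namespace ConvexFanData

variable {n : ℕ} {ι κ : Type*} [DecidableEq ι] (D : ConvexFanData n ι κ)

/-- The generators, as real vectors. -/
def vec (i : ι) : Fin n → ℝ := intVec (D.gen i)

/-- The cone generated by a set of generators. -/
def cone (K : Set ι) : PointedCone ℝ (Fin n → ℝ) := hull ℝ (D.vec '' K)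

/-- The linear functional that agrees with the height function on the cell `I`. As `I` varies, these
are the vertices of the polytope whose normal fan is the fan of `D`. -/
def vertex (I : κ) : Fin n → ℝ := intVec (∑ i ∈ D.cell I, D.height i • D.dual I i)

theorem vec_mem_cone {K : Set ι} {i : ι} (hi : i ∈ K) : D.vec i ∈ D.cone K :=
  subset_hull ⟨i, hi, rfl⟩

theorem cone_mono {K L : Set ι} (h : K ⊆ L) : D.cone K ≤ D.cone L :=
  Submodule.span_mono (Set.image_mono h)

theorem vec_dotProduct_dual {I : κ} {i j : ι} (hi : i ∈ D.cell I) (hj : j ∈ D.cell I) :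
    D.vec i ⬝ᵥ intVec (D.dual I j) = if i = j then 1 else 0 := by
  rw [vec, intVec_dotProduct, D.gen_dotProduct_dual hi hj]
  split_ifs <;> simp

theorem vec_dotProduct_vertex (i : ι) (I : κ) :
    D.vec i ⬝ᵥ D.vertex I = ((∑ j ∈ D.cell I, D.height j * (D.gen i ⬝ᵥ D.dual I j) : ℤ) : ℝ) := by
  simp only [vec, vertex, intVec_dotProduct, dotProduct_sum, dotProduct_smul, smul_eq_mul]

theorem vec_dotProduct_vertex_of_mem {i : ι} {I : κ} (hi : i ∈ D.cell I) :
    D.vec i ⬝ᵥ D.vertex I = D.height i := by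
  rw [vec_dotProduct_vertex, Finset.sum_congr rfl fun j hj => by rw [D.gen_dotProduct_dual hi hj]]
  simp [hi]

theorem vec_dotProduct_vertex_lt {i : ι} {I : κ} (hi : i ∉ D.cell I) :
    D.vec i ⬝ᵥ D.vertex I < D.height i := by
  rw [vec_dotProduct_vertex]
  exact_mod_cast D.sum_lt_height hi

theorem vec_dotProduct_vertex_le (i : ι) (I : κ) : D.vec i ⬝ᵥ D.vertex I ≤ D.height i := by
  by_cases hi : i ∈ D.cell I
  · exact (D.vec_dotProduct_vertex_of_mem hi).le
  · exact (D.vec_dotProduct_vertex_lt hi).le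

theorem isPrimitive_vec (i : ι) : PolyhedralFan.IsPrimitive (D.vec i) := by
  obtain ⟨I, hI⟩ := D.exists_mem_cell i
  have h : D.gen i ⬝ᵥ D.dual I i = 1 := by simp [D.gen_dotProduct_dual hI hI]
  refine ⟨D.gen i, ?_, fun _ => rfl⟩
  rw [← Finset.normalize_gcd, normalize_eq_one, isUnit_iff_dvd_one, ← h]
  exact Finset.dvd_sum fun a _ => (Finset.gcd_dvd (Finset.mem_univ a)).mul_right _

theorem vec_ne_zero (i : ι) : D.vec i ≠ 0 := by
  obtain ⟨I, hI⟩ := D.exists_mem_cell i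
  intro h
  simpa [h] using D.vec_dotProduct_dual hI hI

theorem eq_zero_of_vec_notMem_span {c : ι → ℝ} {i i' : ι} (hneg : D.vec i' = -D.vec i)
    (hspan : D.vec i ∉ Submodule.span ℝ (D.vec '' support c)) : c i = 0 ∧ c i' = 0 := by
  constructor <;> by_contra h
  · exact hspan (Submodule.subset_span (Set.mem_image_of_mem D.vec h))
  · refine hspan (neg_mem_iff.1 (hneg ▸ ?_))
    exact Submodule.subset_span (Set.mem_image_of_mem D.vec h)

/-- The polytope whose normal fan is the fan of `D`. -/
def polytope : Set (Fin n → ℝ) := convexHull ℝ (Set.range D.vertex)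

theorem vertex_mem_polytope (I : κ) : D.vertex I ∈ D.polytope := subset_convexHull _ _ ⟨I, rfl⟩

theorem dotProduct_le_of_mem_polytope {a p : Fin n → ℝ} {r : ℝ} (h : ∀ I, a ⬝ᵥ D.vertex I ≤ r)
    (hp : p ∈ D.polytope) : a ⬝ᵥ p ≤ r := by
  have hconv : Convex ℝ {p : Fin n → ℝ | a ⬝ᵥ p ≤ r} :=
    convex_halfSpace_le ⟨fun x y => dotProduct_add _ x y, fun c x => dotProduct_smul c _ x⟩ _
  exact convexHull_min (Set.range_subset_iff.2 h) hconv hp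

variable [Fintype ι]

theorem mem_cone_iff {K : Set ι} {x : Fin n → ℝ} :
    x ∈ D.cone K ↔ ∃ c : ι → ℝ, 0 ≤ c ∧ support c ⊆ K ∧ ∑ i, c i • D.vec i = x :=
  mem_hull_image_iff

theorem sum_smul_vec_dotProduct (c : ι → ℝ) (y : Fin n → ℝ) :
    (∑ i, c i • D.vec i) ⬝ᵥ y = ∑ i, c i * (D.vec i ⬝ᵥ y) := by
  simp only [sum_dotProduct, smul_dotProduct, smul_eq_mul]

theorem sum_smul_vec_dotProduct_dual {I : κ} {c : ι → ℝ} (hc : support c ⊆ D.cell I) {j : ι}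
    (hj : j ∈ D.cell I) : (∑ i, c i • D.vec i) ⬝ᵥ intVec (D.dual I j) = c j := by
  rw [sum_smul_vec_dotProduct, Finset.sum_eq_single j, D.vec_dotProduct_dual hj hj, if_pos rfl,
    mul_one]
  · intro i _ hij
    by_cases hi : c i = 0
    · rw [hi, zero_mul]
    · rw [D.vec_dotProduct_dual (hc hi) hj, if_neg hij, mul_zero]
  · exact fun h => absurd (Finset.mem_univ j) h

theorem eq_of_sum_smul_vec_eq {I : κ} {c d : ι → ℝ} (hc : support c ⊆ D.cell I)
    (hd : support d ⊆ D.cell I) (h : ∑ i, c i • D.vec i = ∑ i, d i • D.vec i) : c = d := by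
  ext j
  by_cases hj : j ∈ D.cell I
  · rw [← D.sum_smul_vec_dotProduct_dual hc hj, h, D.sum_smul_vec_dotProduct_dual hd hj]
  · rw [notMem_support.1 fun h => hj (hc h), notMem_support.1 fun h => hj (hd h)]

theorem linearIndepOn_cell (I : κ) : LinearIndepOn ℝ D.vec (D.cell I) := by
  refine linearIndepOn_finset_iff.2 fun c hc j hj => ?_
  have h := D.sum_smul_vec_dotProduct_dual (c := fun i => if i ∈ D.cell I then c i else 0)
    (I := I) (fun i hi => by simpa using (ite_ne_right_iff.1 hi).1) hj
  simpa [ite_smul, Finset.sum_ite_mem, hc, hj] using h.symm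

theorem finrank_span_image {I : κ} {K : Set ι} (hK : K ⊆ D.cell I) :
    Module.finrank ℝ (Submodule.span ℝ (D.vec '' K)) = K.ncard := by
  have hv := (D.linearIndepOn_cell I).mono hK
  have := Fintype.ofFinite (D.vec '' K)
  rw [← hv.injOn.ncard_image, finrank_span_set_eq_card hv.id_image, Set.ncard_eq_toFinset_card']

theorem span_cell (I : κ) : Submodule.span ℝ (D.vec '' D.cell I) = ⊤ :=
  Submodule.eq_top_of_finrank_eq <| by
    rw [D.finrank_span_image subset_rfl, Set.ncard_coe_finset, D.card_cell, Module.finrank_fin_fun]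

theorem mem_cone_cell_iff {I : κ} {x : Fin n → ℝ} :
    x ∈ D.cone (D.cell I) ↔ ∀ i ∈ D.cell I, 0 ≤ x ⬝ᵥ intVec (D.dual I i) := by
  constructor
  · intro hx i hi
    obtain ⟨c, hc, hcI, rfl⟩ := D.mem_cone_iff.1 hx
    exact (D.sum_smul_vec_dotProduct_dual hcI hi).symm ▸ hc i
  · intro h
    obtain ⟨l, hl, rfl⟩ := (Finsupp.mem_span_image_iff_linearCombination _).1
      (D.span_cell I ▸ Submodule.mem_top : x ∈ Submodule.span ℝ (D.vec '' D.cell I))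
    have hsum : Finsupp.linearCombination ℝ D.vec l = ∑ i, l i • D.vec i := by
      rw [Finsupp.linearCombination_apply, Finsupp.sum_fintype _ _ (by simp)]
    have hlI : support l ⊆ D.cell I := by rwa [Finsupp.fun_support_eq]
    refine D.mem_cone_iff.2 ⟨l, fun i => ?_, hlI, hsum.symm⟩
    by_cases hi : i ∈ D.cell I
    · exact D.sum_smul_vec_dotProduct_dual hlI hi ▸ hsum ▸ h i hi
    · exact (notMem_support.1 fun h => hi (hlI h)).ge

theorem exists_mem_cone_cell (x : Fin n → ℝ) : ∃ I, x ∈ D.cone (D.cell I) :=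
  (D.cover x).imp fun _ => D.mem_cone_cell_iff.2

theorem sum_smul_vec_dotProduct_vertex_le {c : ι → ℝ} (hc : 0 ≤ c) (I : κ) :
    (∑ i, c i • D.vec i) ⬝ᵥ D.vertex I ≤ ∑ i, c i * D.height i := by
  rw [sum_smul_vec_dotProduct]
  exact Finset.sum_le_sum fun i _ =>
    mul_le_mul_of_nonneg_left (D.vec_dotProduct_vertex_le i I) (hc i)

theorem sum_smul_vec_dotProduct_vertex_eq_iff {c : ι → ℝ} (hc : 0 ≤ c) {I : κ} :
    (∑ i, c i • D.vec i) ⬝ᵥ D.vertex I = ∑ i, c i * D.height i ↔ support c ⊆ D.cell I := by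
  rw [sum_smul_vec_dotProduct, Finset.sum_eq_sum_iff_of_le fun i _ =>
    mul_le_mul_of_nonneg_left (D.vec_dotProduct_vertex_le i I) (hc i)]
  refine ⟨fun h i hi => ?_, fun h i _ => ?_⟩
  · by_contra hiI
    exact (D.vec_dotProduct_vertex_lt hiI).ne (mul_left_cancel₀ hi (h i (Finset.mem_univ i)))
  · by_cases hi : c i = 0
    · simp [hi]
    · rw [D.vec_dotProduct_vertex_of_mem (h hi)]

theorem mem_cone_cell_iff_dotProduct_vertex_le {I : κ} {x : Fin n → ℝ} :
    x ∈ D.cone (D.cell I) ↔ ∀ J, x ⬝ᵥ D.vertex J ≤ x ⬝ᵥ D.vertex I := by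
  constructor
  · intro hx J
    obtain ⟨c, hc, hcI, rfl⟩ := D.mem_cone_iff.1 hx
    rw [(D.sum_smul_vec_dotProduct_vertex_eq_iff hc).2 hcI]
    exact D.sum_smul_vec_dotProduct_vertex_le hc J
  · intro h
    obtain ⟨J, hJ⟩ := D.exists_mem_cone_cell x
    obtain ⟨c, hc, hcJ, rfl⟩ := D.mem_cone_iff.1 hJ
    have hcI := (D.sum_smul_vec_dotProduct_vertex_le hc I).antisymm
      ((D.sum_smul_vec_dotProduct_vertex_eq_iff hc).2 hcJ ▸ h J)
    exact D.mem_cone_iff.2 ⟨c, hc, (D.sum_smul_vec_dotProduct_vertex_eq_iff hc).1 hcI, rfl⟩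

theorem support_subset_cell {c : ι → ℝ} (hc : 0 ≤ c) {I J : κ} (hcI : support c ⊆ D.cell I)
    (hJ : ∑ i, c i • D.vec i ∈ D.cone (D.cell J)) : support c ⊆ D.cell J := by
  refine (D.sum_smul_vec_dotProduct_vertex_eq_iff hc).1
    ((D.sum_smul_vec_dotProduct_vertex_le hc J).antisymm ?_)
  rw [← (D.sum_smul_vec_dotProduct_vertex_eq_iff hc).2 hcI]
  exact D.mem_cone_cell_iff_dotProduct_vertex_le.1 hJ I

theorem cone_inf_cone {K L : Set ι} {I J : κ} (hK : K ⊆ D.cell I) (hL : L ⊆ D.cell J) :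
    D.cone K ⊓ D.cone L = D.cone (K ∩ L) := by
  refine le_antisymm (fun x hx => ?_)
    (le_inf (D.cone_mono Set.inter_subset_left) (D.cone_mono Set.inter_subset_right))
  obtain ⟨c, hc, hcK, rfl⟩ := D.mem_cone_iff.1 hx.1
  obtain ⟨d, -, hdL, hd⟩ := D.mem_cone_iff.1 hx.2
  have hcJ := D.support_subset_cell hc (hcK.trans hK) (D.cone_mono hL hx.2)
  obtain rfl := D.eq_of_sum_smul_vec_eq hcJ (hdL.trans hL) hd.symm
  exact D.mem_cone_iff.2 ⟨c, hc, Set.subset_inter hcK hdL, rfl⟩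

theorem isFaceOf_cone {K L : Set ι} {I : κ} (hK : K ⊆ D.cell I) (hL : L ⊆ K) :
    (D.cone L).IsFaceOf (D.cone K) :=
  isFaceOf_hull_of_linearIndepOn ((D.linearIndepOn_cell I).mono hK).id_image (Set.image_mono hL)

/-- The fan whose cones are generated by the subsets of the cells. -/
def fan : PolyhedralFan n where
  cones := {C | ∃ I, ∃ K ⊆ (D.cell I : Set ι), C = D.cone K}
  nonempty :=
    let ⟨I, _⟩ := D.cover 0
    ⟨D.cone (D.cell I), I, _, subset_rfl, rfl⟩
  finite := (Set.finite_range D.cone).subset <| by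
    rintro _ ⟨I, K, -, rfl⟩
    exact ⟨K, rfl⟩
  polyhedral := by
    rintro _ ⟨I, K, -, rfl⟩
    exact Submodule.fg_span (Set.toFinite _)
  face_mem := by
    rintro _ ⟨I, K, hK, rfl⟩ F hF
    refine ⟨I, {i ∈ K | D.vec i ∈ F}, (Set.sep_subset _ _).trans hK, le_antisymm ?_ ?_⟩
    · intro x hx
      have := mem_hull_inter_of_isFaceOf hF subset_hull (hF.le hx) hx
      rwa [← Set.image_inter_preimage] at this
    · exact Submodule.span_le.2 (Set.image_subset_iff.2 fun i hi => hi.2)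
  inter_face := by
    rintro _ ⟨I, K, hK, rfl⟩ _ ⟨J, L, hL, rfl⟩
    rw [D.cone_inf_cone hK hL]
    exact ⟨D.isFaceOf_cone hK Set.inter_subset_left, D.isFaceOf_cone hL Set.inter_subset_right⟩

theorem cone_cell_mem_fan (I : κ) : D.cone (D.cell I) ∈ D.fan.cones :=
  ⟨I, D.cell I, subset_rfl, rfl⟩

theorem isComplete_fan : D.fan.IsComplete := fun x =>
  let ⟨I, hI⟩ := D.exists_mem_cone_cell x
  ⟨_, D.cone_cell_mem_fan I, hI⟩

theorem coneDim_cone {I : κ} {K : Set ι} (hK : K ⊆ D.cell I) :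
    PolyhedralFan.coneDim (D.cone K) = K.ncard := by
  rw [PolyhedralFan.coneDim, cone, span_hull, D.finrank_span_image hK]

theorem coneMultiplicity_image {I : κ} {K : Set ι} (hK : K ⊆ D.cell I) :
    PolyhedralFan.coneMultiplicity (D.vec '' K) = 1 := by
  rw [PolyhedralFan.coneMultiplicity, AddSubgroup.relIndex_eq_one]
  rintro _ ⟨⟨z, rfl⟩, hx⟩
  obtain ⟨c, hcK, hsum⟩ := (Finsupp.mem_span_image_iff_linearCombination ℝ).1 hx
  rw [Finsupp.linearCombination_apply, Finsupp.sum_fintype _ _ (by simp)] at hsum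
  rw [← hsum]
  refine AddSubgroup.sum_mem _ fun i _ => ?_
  by_cases hi : c i = 0
  · rw [hi, zero_smul]
    exact zero_mem _
  · have hiK : i ∈ K := hcK (Finsupp.mem_support_iff.2 hi)
    have hint : c i = ((z ⬝ᵥ D.dual I i : ℤ) : ℝ) := by
      have hcI : support c ⊆ D.cell I := by
        rw [Finsupp.fun_support_eq]
        exact hcK.trans hK
      rw [← intVec_dotProduct, ← D.sum_smul_vec_dotProduct_dual hcI (hK hiK), hsum]
      rfl
    rw [hint, Int.cast_smul_eq_zsmul]
    exact AddSubgroup.zsmul_mem _ (AddSubgroup.subset_closure (Set.mem_image_of_mem _ hiK)) _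

theorem isUnimodular_fan : D.fan.IsUnimodular where
  unimodularCone := by
    rintro _ ⟨I, K, hK, rfl⟩
    refine ⟨D.vec '' K, ⟨Set.toFinite _, ?_, ?_, rfl⟩, D.coneMultiplicity_image hK⟩
    · rintro _ ⟨i, -, rfl⟩
      exact D.isPrimitive_vec i
    · exact ((D.linearIndepOn_cell I).mono hK).id_image
  fullDimensional := by
    rintro _ ⟨I, K, hK, rfl⟩
    exact ⟨D.cone (D.cell I), D.cone_cell_mem_fan I, D.cone_mono hK, by
      rw [D.coneDim_cone subset_rfl, Set.ncard_coe_finset, D.card_cell]⟩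

theorem rays_fan : D.fan.rays = Set.range fun i => D.cone {i} := by
  ext C
  constructor
  · rintro ⟨⟨I, K, hK, rfl⟩, hdim⟩
    rw [D.coneDim_cone hK, Set.ncard_eq_one] at hdim
    obtain ⟨i, rfl⟩ := hdim
    exact ⟨i, rfl⟩
  · rintro ⟨i, rfl⟩
    obtain ⟨I, hI⟩ := D.exists_mem_cell i
    have hI' : {i} ⊆ (D.cell I : Set ι) := Set.singleton_subset_iff.2 hI
    exact ⟨⟨I, _, hI', rfl⟩, by rw [D.coneDim_cone hI', Set.ncard_singleton]⟩

theorem injective_cone_singleton : Injective fun i => D.cone {i} := by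
  intro i j h
  obtain ⟨I, hI⟩ := D.exists_mem_cell i
  obtain ⟨J, hJ⟩ := D.exists_mem_cell j
  have hinf := D.cone_inf_cone (Set.singleton_subset_iff.2 hI) (Set.singleton_subset_iff.2 hJ)
  rw [show D.cone {i} = D.cone {j} from h, inf_idem] at hinf
  by_contra hij
  have hj : D.vec j ∈ D.cone ({i} ∩ {j}) := hinf ▸ D.vec_mem_cone rfl
  rw [Set.singleton_inter_eq_empty.2 (by simpa using hij)] at hj
  exact D.vec_ne_zero j (by simpa [cone] using hj)

theorem ncard_rays_fan : D.fan.rays.ncard = Fintype.card ι := by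
  rw [rays_fan, ← Set.image_univ, Set.ncard_image_of_injective _ D.injective_cone_singleton,
    Set.ncard_univ, Nat.card_eq_fintype_card]

section Polytopal

open PolyhedralFan

theorem vertex_mem_faceInDirection_iff {a : Fin n → ℝ} {I : κ} :
    D.vertex I ∈ faceInDirection D.polytope a ↔ a ∈ D.cone (D.cell I) := by
  simp only [faceInDirection, Set.mem_ofPred_eq, D.vertex_mem_polytope, true_and, dotProduct_sub,
    sub_nonneg, mem_cone_cell_iff_dotProduct_vertex_le]
  exact ⟨fun h J => h _ (D.vertex_mem_polytope J), fun h x => D.dotProduct_le_of_mem_polytope h⟩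

theorem isClosed_cone_cell (I : κ) : IsClosed (D.cone (D.cell I) : Set (Fin n → ℝ)) := by
  have h : (D.cone (D.cell I) : Set (Fin n → ℝ)) =
      ⋂ J, {x | x ⬝ᵥ D.vertex J ≤ x ⬝ᵥ D.vertex I} := by
    ext x
    simp [mem_cone_cell_iff_dotProduct_vertex_le]
  rw [h]
  refine isClosed_iInter fun J => isClosed_le ?_ ?_ <;> fun_prop

theorem exists_sub_smul_mem_cone_cell [Finite κ] (a b : Fin n → ℝ) :
    ∃ t : ℝ, 0 < t ∧ ∃ I, a ∈ D.cone (D.cell I) ∧ a - t • b ∈ D.cone (D.cell I) := by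
  obtain ⟨I, hI⟩ : ∃ I, ∃ᶠ t in nhdsWithin (0 : ℝ) (Set.Ioi 0), a - t • b ∈ D.cone (D.cell I) := by
    by_contra! h
    obtain ⟨t, ht⟩ := (Filter.eventually_all.2 h).exists
    obtain ⟨I, hI⟩ := D.exists_mem_cone_cell (a - t • b)
    exact ht I hI
  have hlim : Filter.Tendsto (fun t : ℝ => a - t • b) (nhdsWithin 0 (Set.Ioi 0)) (nhds a) :=
    (Continuous.tendsto' (by fun_prop) _ _ (by simp)).mono_left nhdsWithin_le_nhds
  obtain ⟨t, ht, ht0⟩ := (hI.and_eventually self_mem_nhdsWithin).exists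
  exact ⟨t, ht0, I, (D.isClosed_cone_cell I).mem_of_frequently_of_tendsto hI hlim, ht⟩

theorem cone_support_le_normalCone {c : ι → ℝ} (hc : 0 ≤ c) {I : κ} (hcI : support c ⊆ D.cell I) :
    D.cone (support c) ≤
      normalCone D.polytope (faceInDirection D.polytope (∑ i, c i • D.vec i)) := by
  intro b hb p hp q hq
  obtain ⟨t, ht, hx⟩ := exists_pos_sub_smul_mem_hull hc (hull_le_span ℝ _ hb)
  have hI : ∀ y ∈ D.cone (support c), ∀ q ∈ D.polytope, y ⬝ᵥ q ≤ y ⬝ᵥ D.vertex I := fun y hy q =>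
    D.dotProduct_le_of_mem_polytope
      (D.mem_cone_cell_iff_dotProduct_vertex_le.1 (D.cone_mono hcI hy))
  have hap := hp.2 _ (D.vertex_mem_polytope I)
  have hxp := hI _ hx p hp.1
  have hbq := hI b hb q hq
  rw [sub_dotProduct, sub_dotProduct, smul_dotProduct, smul_dotProduct, smul_eq_mul,
    smul_eq_mul] at hxp
  rw [dotProduct_sub] at hap ⊢
  nlinarith

theorem normalCone_le_cone_support [Finite κ] {c : ι → ℝ} (hc : 0 ≤ c) {I : κ}
    (hcI : support c ⊆ D.cell I) :
    normalCone D.polytope (faceInDirection D.polytope (∑ i, c i • D.vec i)) ≤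
      D.cone (support c) := by
  intro b hb
  obtain ⟨t, ht, J, ha, hx⟩ := D.exists_sub_smul_mem_cone_cell (∑ i, c i • D.vec i) b
  have hbJ : b ∈ D.cone (D.cell J) := D.mem_cone_cell_iff_dotProduct_vertex_le.2 fun J' => by
    have h := hb _ (D.vertex_mem_faceInDirection_iff.2 ha) _ (D.vertex_mem_polytope J')
    rwa [dotProduct_sub, sub_nonneg] at h
  have hface := D.isFaceOf_cone (subset_refl (D.cell J : Set ι)) (D.support_subset_cell hc hcI ha)
  refine hface.mem_of_smul_add_mem hbJ hx ht ?_
  rw [add_sub_cancel]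
  exact D.mem_cone_iff.2 ⟨c, hc, subset_rfl, rfl⟩

theorem normalCone_faceInDirection [Finite κ] {c : ι → ℝ} (hc : 0 ≤ c) {I : κ}
    (hcI : support c ⊆ D.cell I) :
    normalCone D.polytope (faceInDirection D.polytope (∑ i, c i • D.vec i)) = D.cone (support c) :=
  (D.normalCone_le_cone_support hc hcI).antisymm (D.cone_support_le_normalCone hc hcI)

theorem isPolytopal_fan [Finite κ] : D.fan.IsPolytopal := by
  classical
  obtain ⟨I, -⟩ := D.cover 0
  have hfin := Set.finite_range D.vertex
  refine ⟨hfin.toFinset, ⟨D.vertex I, by simp⟩, ?_⟩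
  rw [hfin.coe_toFinset]
  ext C
  constructor
  · rintro ⟨I, K, hK, rfl⟩
    have hsupp : support (K.indicator (1 : ι → ℝ)) = K := by simp [Set.support_indicator]
    have h := D.normalCone_faceInDirection (c := K.indicator (1 : ι → ℝ))
      (Set.indicator_nonneg fun _ _ => zero_le_one) (hsupp.trans_subset hK)
    rw [hsupp] at h
    exact ⟨_, h.symm⟩
  · rintro ⟨a, rfl⟩
    obtain ⟨I, hI⟩ := D.exists_mem_cone_cell a
    obtain ⟨c, hc, hcI, rfl⟩ := D.mem_cone_iff.1 hI
    exact ⟨I, _, hcI, D.normalCone_faceInDirection hc hcI⟩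

end Polytopal

section Coarsening

variable {D} {𝒩 : PolyhedralFan n}

theorem card_le_ncard_rays (hrays : ∀ j, D.cone {j} ∈ 𝒩.cones) :
    Fintype.card ι ≤ 𝒩.rays.ncard := by
  rw [← D.ncard_rays_fan]
  refine Set.ncard_le_ncard (fun C hC => ⟨?_, hC.2⟩) (𝒩.finite.subset (Set.sep_subset _ _))
  obtain ⟨j, rfl⟩ := D.rays_fan ▸ hC
  exact hrays j

variable (href : D.fan.Refines 𝒩)
include href

theorem exists_cone_cell_le (I : κ) : ∃ C ∈ 𝒩.cones, D.cone (D.cell I) ≤ C :=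
  href _ (D.cone_cell_mem_fan I)

theorem eq_cone_of_mem_coarsening {C : PointedCone ℝ (Fin n → ℝ)} (hC : C ∈ 𝒩.cones) :
    C = D.cone {i | D.vec i ∈ C} := by
  refine le_antisymm (fun x hx => ?_) (Submodule.span_le.2 (Set.image_subset_iff.2 fun i hi => hi))
  obtain ⟨I, hI⟩ := D.exists_mem_cone_cell x
  obtain ⟨C', hC', hle⟩ := exists_cone_cell_le href I
  have hxI := mem_hull_inter_of_isFaceOf (𝒩.inter_face C hC C' hC').2 (subset_hull.trans hle) hI
    ⟨hx, hle hI⟩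
  refine Submodule.span_mono ?_ hxI
  rintro _ ⟨⟨i, -, rfl⟩, hi, -⟩
  exact ⟨i, hi, rfl⟩

theorem exists_combination_of_cone_singleton_notMem (hsal : 𝒩.IsSalient) {j : ι}
    (hj : D.cone {j} ∉ 𝒩.cones) : ∃ c : ι → ℝ, 0 ≤ c ∧ c j = 0 ∧ ∑ i, c i • D.vec i = D.vec j ∧
      ∀ C ∈ 𝒩.cones, D.vec j ∈ C → D.cone (support c) ≤ C := by
  obtain ⟨I, hjI⟩ := D.exists_mem_cell j
  obtain ⟨C, hC, hle⟩ := exists_cone_cell_le href I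
  have hjC : D.vec j ∈ C := hle (D.vec_mem_cone hjI)
  have hCeq : C = hull ℝ (D.vec '' {i | D.vec i ∈ C}) := eq_cone_of_mem_coarsening href hC
  have hmem : D.vec j ∈ hull ℝ (D.vec '' {i | D.vec i ∈ C} \ {D.vec j}) := by
    by_contra hnot
    have hsalC := hsal C hC
    rw [hCeq] at hsalC
    have hface := isFaceOf_hull_singleton hsalC (Set.mem_image_of_mem D.vec hjC) hnot
    rw [← Set.image_singleton, ← hCeq] at hface
    exact hj (𝒩.face_mem C hC _ hface)
  have hsub : D.vec '' {i | D.vec i ∈ C} \ {D.vec j} ⊆ D.vec '' {i | D.vec i ∈ C ∧ i ≠ j} := by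
    rintro _ ⟨⟨i, hi, rfl⟩, hij⟩
    exact ⟨i, ⟨hi, fun h => hij (h ▸ rfl)⟩, rfl⟩
  obtain ⟨c, hc, hcC, hsum⟩ := mem_hull_image_iff.1 (Submodule.span_mono hsub hmem)
  refine ⟨c, hc, by_contra fun h => (hcC h).2 rfl, hsum, fun C' hC' hjC' => ?_⟩
  have hsmul : ∀ i, c i • D.vec i ∈ C := fun i => by
    by_cases hi : c i = 0
    · simp [hi]
    · exact C.smul_mem (hc i) (hcC hi).1
  have hmem : ∑ i, c i • D.vec i ∈ C ⊓ C' := by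
    rw [hsum]
    exact ⟨hjC, hjC'⟩
  have hface := (𝒩.inter_face C hC C' hC').1.mem_of_sum_mem hsmul hmem
  refine Submodule.span_le.2 (Set.image_subset_iff.2 fun i hi => ?_)
  exact (smul_mem_iff C' (lt_of_le_of_ne (hc i) (Ne.symm hi))).1 (hface i).2

theorem vec_notMem_span_of_vec_eq_neg (hsal : 𝒩.IsSalient) {c : ι → ℝ} (hc : 0 ≤ c) {j : ι}
    (hsum : ∑ i, c i • D.vec i = D.vec j)
    (hle : ∀ C ∈ 𝒩.cones, D.vec j ∈ C → D.cone (support c) ≤ C) {i i' : ι} {I I' : κ}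
    (hjI : j ∈ D.cell I) (hiI : i ∈ D.cell I) (hjI' : j ∈ D.cell I') (hiI' : i' ∈ D.cell I')
    (hneg : D.vec i' = -D.vec i) : D.vec i ∉ Submodule.span ℝ (D.vec '' support c) := by
  intro hspan
  obtain ⟨C, hC, hIC⟩ := exists_cone_cell_le href I
  obtain ⟨C', hC', hIC'⟩ := exists_cone_cell_le href I'
  have hjC := hIC (D.vec_mem_cone hjI)
  have hjC' := hIC' (D.vec_mem_cone hjI')
  obtain ⟨t, ht, hy⟩ := exists_pos_sub_smul_mem_hull hc hspan
  rw [hsum] at hy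
  have hi := (𝒩.inter_face C hC C' hC').1.mem_of_smul_add_mem (hIC (D.vec_mem_cone hiI))
    (hle C hC hjC hy) ht (by rw [add_sub_cancel]; exact ⟨hjC, hjC'⟩)
  have hlineal : D.vec i ∈ C'.lineal :=
    mem_lineal.2 ⟨hi.2, hneg ▸ hIC' (D.vec_mem_cone hiI')⟩
  rw [hsal C' hC', Submodule.mem_bot] at hlineal
  exact D.vec_ne_zero i hlineal

theorem fan_eq_of_isSimplicial (hsimp : 𝒩.IsSimplicial) (hrays : ∀ j, D.cone {j} ∈ 𝒩.cones) :
    D.fan = 𝒩 := by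
  refine D.isComplete_fan.eq_of_cones_subset ?_
  rintro _ ⟨I, K, hK, rfl⟩
  refine 𝒩.face_mem _ ?_ _ (D.isFaceOf_cone subset_rfl hK)
  obtain ⟨C, hC, hle⟩ := exists_cone_cell_le href I
  obtain ⟨s, -, hs, rfl⟩ := hsimp C hC
  have hvec : D.cone (D.cell I) ≤ hull ℝ (s ∩ D.cone (D.cell I)) := by
    refine Submodule.span_le.2 (Set.image_subset_iff.2 fun i hi => ?_)
    have hiI : D.cone {i} ≤ D.cone (D.cell I) := D.cone_mono (Set.singleton_subset_iff.2 hi)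
    have hface := (𝒩.inter_face _ hC _ (hrays i)).1
    rw [inf_eq_right.2 (hiI.trans hle)] at hface
    have hmem := D.vec_mem_cone (Set.mem_singleton i)
    exact Submodule.span_mono (Set.inter_subset_inter_right s hiI)
      (mem_hull_inter_of_isFaceOf hface subset_hull (hface.le hmem) hmem)
  have hspan : Submodule.span ℝ (s ∩ D.cone (D.cell I)) = ⊤ := by
    rw [eq_top_iff, ← D.span_cell I, Submodule.span_le]
    exact fun v hv => hull_le_span ℝ _ (hvec (subset_hull hv))
  have hsI : s ∩ D.cone (D.cell I) = s :=
    (eq_of_linearIndepOn_id_of_span_subtype hs Set.inter_subset_left (by simp [hspan])).symm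
  rwa [hle.antisymm (Submodule.span_le.2 (Set.inter_eq_left.1 hsI))]

end Coarsening

end ConvexFanData

namespace SlopeFan

variable {k : ℕ}

/-- The three horizontal generators beside those on the parabola. -/
inductive Side
  | north | west | south
  deriving DecidableEq

instance : Fintype Side := ⟨{.north, .west, .south}, by rintro ⟨⟩ <;> decide⟩

/-- Index set of the generators away from the vertical axis, one for each of the slopes `0, …, k`
and one for each side. -/
abbrev PlaneRay (k : ℕ) := Fin (k + 1) ⊕ Side

/-- Index set of all generators; the Booleans stand for the upper and the lower pole. -/
abbrev Ray (k : ℕ) := Bool ⊕ PlaneRay k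

open Sum Side

/-- The counterclockwise successor, for the projections of the generators along the vertical
axis. -/
def next : PlaneRay k → PlaneRay k
  | inl l => Fin.lastCases (inr north) (fun i => inl i.succ) l
  | inr north => inr west
  | inr west => inr south
  | inr south => inl 0

theorem forall_next {P : PlaneRay k → PlaneRay k → Prop}
    (slope : ∀ i : Fin k, P (inl i.castSucc) (inl i.succ))
    (last : P (inl (Fin.last k)) (inr north)) (north_west : P (inr north) (inr west))
    (west_south : P (inr west) (inr south)) (south_zero : P (inr south) (inl 0)) (j : PlaneRay k) :
    P j (next j) := by
  rcases j with l | _ | _ | _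
  · induction l using Fin.lastCases with
    | last => simpa only [next, Fin.lastCases_last] using last
    | cast i => simpa only [next, Fin.lastCases_castSucc] using slope i
  · exact north_west
  · exact west_south
  · exact south_zero

/-- The generators away from the vertical axis. -/
def planeGen : PlaneRay k → Fin 3 → ℤ
  | inl l => ![1, (l : ℕ), (l : ℕ) ^ 2]
  | inr north => ![0, 1, 0]
  | inr west => ![-1, 0, 0]
  | inr south => ![0, -1, 0]

/-- The vertical coordinate of a pole. -/
def sign (b : Bool) : ℤ := if b then 1 else -1

theorem sign_mul_sign (b : Bool) : sign b * sign b = 1 := by cases b <;> rfl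

/-- The generators of the rays of the fan. -/
def gen : Ray k → Fin 3 → ℤ
  | inl b => ![0, 0, sign b]
  | inr j => planeGen j

/-- The determinant of the projections of two vectors along the vertical axis. -/
def planeDet {R : Type*} [CommRing R] (u w : Fin 3 → R) : R := u 0 * w 1 - u 1 * w 0

theorem planeDet_next (j : PlaneRay k) : planeDet (planeGen j) (planeGen (next j)) = 1 := by
  refine forall_next (P := fun j j' => planeDet (planeGen j) (planeGen j') = 1) ?_ ?_ ?_ ?_ ?_ j
    <;> simp [planeDet, planeGen]

theorem next_ne (j : PlaneRay k) : next j ≠ j := by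
  intro h
  simpa [h, planeDet, mul_comm] using planeDet_next j

/-- The maximal cones of the fan lie between a pole and two consecutive other rays. -/
def cell (I : Bool × PlaneRay k) : Finset (Ray k) := {inl I.1, inr I.2, inr (next I.2)}

theorem forall_mem_cell {P : Ray k → Prop} {I : Bool × PlaneRay k} :
    (∀ i ∈ cell I, P i) ↔ P (inl I.1) ∧ P (inr I.2) ∧ P (inr (next I.2)) := by
  simp [cell]

/-- The basis dual to the generators of a cell. -/
def dual (I : Bool × PlaneRay k) : Ray k → Fin 3 → ℤ :=
  let u := planeGen I.2
  let w := planeGen (next I.2)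
  fun
  | inl _ => sign I.1 • ![w 2 * u 1 - u 2 * w 1, u 2 * w 0 - w 2 * u 0, 1]
  | inr m => if m = I.2 then ![w 1, -w 0, 0] else ![-u 1, u 0, 0]

theorem dotProduct_dual_pole {R : Type*} [CommRing R] (x : Fin 3 → R) (I : Bool × PlaneRay k) (b) :
    x ⬝ᵥ (fun a => (dual I (inl b) a : R)) = sign I.1 * (x 2
      - planeDet x (fun a => (planeGen (next I.2) a : R)) * planeGen I.2 2
      - planeDet (fun a => (planeGen I.2 a : R)) x * planeGen (next I.2) 2) := by
  simp only [dual, planeDet, Matrix.vec3_dotProduct, Matrix.cons_val, Pi.smul_apply, smul_eq_mul]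
  push_cast
  ring

theorem dotProduct_dual_self {R : Type*} [CommRing R] (x : Fin 3 → R) (I : Bool × PlaneRay k) :
    x ⬝ᵥ (fun a => (dual I (inr I.2) a : R)) =
      planeDet x (fun a => (planeGen (next I.2) a : R)) := by
  simp only [dual, planeDet, Matrix.vec3_dotProduct, Matrix.cons_val, if_true]
  push_cast
  ring

theorem dotProduct_dual_next {R : Type*} [CommRing R] (x : Fin 3 → R) (I : Bool × PlaneRay k) :
    x ⬝ᵥ (fun a => (dual I (inr (next I.2)) a : R)) =
      planeDet (fun a => (planeGen I.2 a : R)) x := by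
  simp only [dual, next_ne, planeDet, Matrix.vec3_dotProduct, Matrix.cons_val, if_false]
  push_cast
  ring

theorem gen_dotProduct_dual {I : Bool × PlaneRay k} {i j : Ray k} (hi : i ∈ cell I)
    (hj : j ∈ cell I) : gen i ⬝ᵥ dual I j = if i = j then 1 else 0 := by
  have hdet := planeDet_next I.2
  have hpole := fun x => dotProduct_dual_pole (R := ℤ) x I I.1
  have hself := fun x => dotProduct_dual_self (R := ℤ) x I
  have hnext := fun x => dotProduct_dual_next (R := ℤ) x I
  simp only [Int.cast_id] at hpole hself hnext
  have hne := next_ne I.2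
  have key : ∀ i ∈ cell I, ∀ j ∈ cell I, gen i ⬝ᵥ dual I j = if i = j then 1 else 0 := by
    simp only [forall_mem_cell, hpole, hself, hnext, gen, inr.injEq, reduceCtorEq,
      if_true, if_false, hne, hne.symm, hdet]
    simp [planeDet, mul_comm, sign_mul_sign]
  exact key i hi j hj

theorem card_cell (I : Bool × PlaneRay k) : (cell I).card = 3 :=
  Finset.card_eq_three.2 ⟨_, _, _, inl_ne_inr, inl_ne_inr, inr_injective.ne (next_ne I.2).symm, rfl⟩

theorem exists_mem_cell (i : Ray k) : ∃ I, i ∈ cell I := by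
  rcases i with b | j
  · exact ⟨(b, inr north), by simp [cell]⟩
  · exact ⟨(true, j), by simp [cell]⟩

theorem exists_planeDet_nonneg (x : Fin 3 → ℝ) : ∃ j : PlaneRay k,
    0 ≤ planeDet x (intVec (planeGen (next j))) ∧ 0 ≤ planeDet (intVec (planeGen j)) x := by
  rcases le_total (x 0) 0 with hx | hx
  · rcases le_total (x 1) 0 with hy | hy
    · exact ⟨inr west, by simp [planeDet, intVec, planeGen, next, hx, hy]⟩
    · exact ⟨inr north, by simp [planeDet, intVec, planeGen, next, hx, hy]⟩
  rcases le_total (x 1) 0 with hy | hy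
  · exact ⟨inr south, by simp [planeDet, intVec, planeGen, next, hx, hy]⟩
  rcases le_or_gt (k * x 0) (x 1) with hk | hk
  · exact ⟨inl (Fin.last k), by simp [planeDet, intVec, planeGen, next, hx, hk, mul_comm]⟩
  have hx' : 0 < x 0 := hx.lt_of_ne fun h => by simp [← h, hy.not_gt] at hk
  have hlt : ⌊x 1 / x 0⌋₊ < k := (Nat.floor_lt (div_nonneg hy hx)).2 ((div_lt_iff₀ hx').2 hk)
  have hfloor := (le_div_iff₀ hx').1 (Nat.floor_le (div_nonneg hy hx))
  have hfloor_succ := (div_lt_iff₀ hx').1 (Nat.lt_floor_add_one (x 1 / x 0))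
  obtain ⟨i, hi⟩ : ∃ i : Fin k, (i : ℕ) = ⌊x 1 / x 0⌋₊ := ⟨⟨_, hlt⟩, rfl⟩
  rw [← hi] at hfloor hfloor_succ
  refine ⟨inl i.castSucc, ?_, ?_⟩
  · simpa [planeDet, intVec, planeGen, next, mul_comm] using hfloor_succ.le
  · simpa [planeDet, intVec, planeGen, mul_comm] using hfloor

theorem cover (x : Fin 3 → ℝ) :
    ∃ I : Bool × PlaneRay k, ∀ i ∈ cell I, 0 ≤ x ⬝ᵥ intVec (dual I i) := by
  obtain ⟨j, hself, hnext⟩ := exists_planeDet_nonneg (k := k) x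
  obtain ⟨b, hpole⟩ : ∃ b, 0 ≤ x ⬝ᵥ intVec (dual (b, j) (inl b)) := by
    have hneg : intVec (dual (false, j) (inl false)) = -intVec (dual (true, j) (inl true)) := by
      ext a
      fin_cases a <;> simp [intVec, dual, sign]
    rcases le_total 0 (x ⬝ᵥ intVec (dual (true, j) (inl true))) with h | h
    · exact ⟨true, h⟩
    · exact ⟨false, by rwa [hneg, dotProduct_neg, neg_nonneg]⟩
  refine ⟨(b, j), forall_mem_cell.2 ⟨hpole, ?_, ?_⟩⟩
  · exact hself.trans_eq (dotProduct_dual_self x (b, j)).symm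
  · exact hnext.trans_eq (dotProduct_dual_next x (b, j)).symm

/-- A strictly convex function on the plane, linear between consecutive generators; the values at
the sides only need to be large. -/
def planeHeight (a : ℤ) : PlaneRay k → ℤ
  | inl l => a * (l : ℕ) ^ 2
  | inr north => 4 * k + 1
  | inr west => k * (4 * k + 1) + 1
  | inr south => 0

theorem planeHeight_convex_slope {a : ℤ} (ha : 0 < a) (ha2 : a ≤ 2) (i : Fin k) {m : PlaneRay k}
    (hm : m ≠ inl i.castSucc) (hm' : m ≠ inl i.succ) :
    planeHeight a (inl i.castSucc) * planeDet (planeGen m) (planeGen (inl i.succ)) +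
      planeHeight a (inl i.succ) * planeDet (planeGen (inl i.castSucc)) (planeGen m) <
        planeHeight a m := by
  have hik : (i : ℤ) + 1 ≤ k := by exact_mod_cast i.2
  have hi : (0 : ℤ) ≤ (i : ℕ) := by positivity
  have hai := mul_nonneg (sub_nonneg.2 ha2) hi
  rcases m with r | _ | _ | _ <;> simp only [planeDet, planeGen, planeHeight, Fin.val_castSucc,
    Fin.val_succ, Nat.cast_add, Nat.cast_one, Matrix.cons_val_zero, Matrix.cons_val_one]
  · have hr : (r : ℤ) ≠ i := fun h => hm (congrArg inl (Fin.ext (by exact_mod_cast h)))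
    have hr' : (r : ℤ) ≠ i + 1 := fun h => hm' (congrArg inl (Fin.ext (by exact_mod_cast h)))
    have hpos : 0 < ((r : ℤ) - i) * (r - (i + 1)) := by
      rcases lt_or_gt_of_ne hr with h | h
      · exact mul_pos_of_neg_of_neg (by omega) (by omega)
      · exact mul_pos (by omega) (by omega)
    nlinarith
  · nlinarith
  · nlinarith [mul_nonneg hai hi, mul_nonneg hi (sub_nonneg.2 hik)]
  · nlinarith [mul_nonneg ha.le hi]

theorem planeHeight_convex_last {a : ℤ} (ha : 0 < a) (ha2 : a ≤ 2) {m : PlaneRay k}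
    (hm : m ≠ inl (Fin.last k)) (hm' : m ≠ inr north) :
    planeHeight a (inl (Fin.last k)) * planeDet (planeGen m) (planeGen (inr north : PlaneRay k)) +
      planeHeight a (inr north : PlaneRay k) * planeDet (planeGen (inl (Fin.last k))) (planeGen m) <
        planeHeight a m := by
  rcases m with r | _ | _ | _ <;> simp only [planeDet, planeGen, planeHeight, Fin.val_last,
    Matrix.cons_val_zero, Matrix.cons_val_one]
  · have hr : (r : ℤ) < k := by exact_mod_cast Fin.val_lt_last fun h => hm (congrArg inl h)
    nlinarith [mul_nonneg (sub_nonneg.2 ha2) (Int.natCast_nonneg (r : ℕ)),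
      mul_nonneg (sub_nonneg.2 ha2) (sub_nonneg.2 hr.le)]
  · exact absurd rfl hm'
  · nlinarith
  · nlinarith

theorem planeHeight_convex {a : ℤ} (ha : 0 < a) (ha2 : a ≤ 2) {j m : PlaneRay k} (hm : m ≠ j)
    (hm' : m ≠ next j) :
    planeHeight a j * planeDet (planeGen m) (planeGen (next j)) +
      planeHeight a (next j) * planeDet (planeGen j) (planeGen m) < planeHeight a m := by
  revert m
  refine forall_next (P := fun j j' => ∀ {m}, m ≠ j → m ≠ j' →
    planeHeight a j * planeDet (planeGen m) (planeGen j') +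
      planeHeight a j' * planeDet (planeGen j) (planeGen m) < planeHeight a m)
    (fun i _ => planeHeight_convex_slope ha ha2 i) (planeHeight_convex_last ha ha2) ?_ ?_ ?_ j
    <;> intro m hm hm' <;> rcases m with r | _ | _ | _ <;> try contradiction
  all_goals simp only [planeDet, planeGen, planeHeight, Matrix.cons_val_zero, Matrix.cons_val_one]
  · have hr : (r : ℤ) ≤ k := by exact_mod_cast Fin.is_le r
    nlinarith [mul_nonneg ha.le (sq_nonneg (r : ℤ))]
  · linarith
  · nlinarith [mul_nonneg ha.le (sq_nonneg (r : ℤ))]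
  · linarith
  · have hr : (r : ℤ) ≠ 0 := by
      simpa using (inl_injective (β := Side)).ne_iff.1 hm'
    have hpos := mul_pos ha (sq_pos_of_ne_zero hr)
    simpa using hpos
  · linarith
  · nlinarith

/-- The heights certifying that the fan is polytopal. Raising the upper pole to `1` subtracts the
vertical coordinate from `planeHeight 2`, leaving `planeHeight 1`, on the upper cells. -/
def height : Ray k → ℤ
  | inl b => if b then 1 else 0
  | inr j => planeHeight 2 j

theorem sum_height_mul_dotProduct_dual (I : Bool × PlaneRay k) (x : Fin 3 → ℤ) :
    ∑ i ∈ cell I, height i * (x ⬝ᵥ dual I i) =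
      height (inl I.1 : Ray k) * (x ⬝ᵥ dual I (inl I.1)) +
        (planeHeight 2 I.2 * planeDet x (planeGen (next I.2)) +
          planeHeight 2 (next I.2) * planeDet (planeGen I.2) x) := by
  have hself := dotProduct_dual_self x I
  have hnext := dotProduct_dual_next x I
  simp only [Int.cast_id] at hself hnext
  rw [cell, Finset.sum_insert (by simp), Finset.sum_pair (by simp [(next_ne I.2).symm]), hself,
    hnext]
  rfl

theorem planeHeight_one (j : PlaneRay k) : planeHeight 1 j = planeHeight 2 j - planeGen j 2 := by
  rcases j with l | _ | _ | _ <;> simp only [planeHeight, planeGen, Matrix.cons_val] <;>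
    ring

theorem sum_lt_height {I : Bool × PlaneRay k} {j : Ray k} (hj : j ∉ cell I) :
    ∑ i ∈ cell I, height i * (gen j ⬝ᵥ dual I i) < height j := by
  obtain ⟨b, l⟩ := I
  have hpole := dotProduct_dual_pole (gen j) (b, l) b
  simp only [Int.cast_id] at hpole
  rw [sum_height_mul_dotProduct_dual, hpole]
  simp only [cell, Finset.mem_insert, Finset.mem_singleton, not_or] at hj
  rcases j with b' | m
  · cases b <;> cases b' <;> simp_all [height, gen, planeDet, sign]
  · have hm : m ≠ l := by simpa using hj.2.1
    have hm' : m ≠ next l := by simpa using hj.2.2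
    cases b
    · simpa [height, gen] using planeHeight_convex zero_lt_two le_rfl hm hm'
    · have h := planeHeight_convex zero_lt_one one_le_two hm hm'
      simp only [planeHeight_one] at h
      simp only [height, gen, sign, if_true]
      linarith

/-- The certificate of the fan with rays through the poles, the sides and the vectors `(1, l, l²)`
for `l = 0, …, k`. -/
def data (k : ℕ) : ConvexFanData 3 (Ray k) (Bool × PlaneRay k) where
  gen := gen
  cell := cell
  dual := dual
  height := height
  card_cell := card_cell
  exists_mem_cell := exists_mem_cell
  gen_dotProduct_dual := gen_dotProduct_dual
  sum_lt_height := sum_lt_height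
  cover := cover

theorem card_ray : Fintype.card (Ray k) = k + 6 := by
  simp only [Ray, PlaneRay, Fintype.card_sum, Fintype.card_bool, Fintype.card_fin]
  rw [show Fintype.card Side = 3 from rfl]
  omega

theorem vec_up : (data k).vec (inl true) = ![0, 0, 1] := by
  ext a
  fin_cases a <;> simp [ConvexFanData.vec, data, gen, intVec, sign]

theorem vec_down : (data k).vec (inl false) = -(data k).vec (inl true) := by
  ext a
  fin_cases a <;> simp [ConvexFanData.vec, data, gen, intVec, sign]

theorem vec_slope (l : Fin (k + 1)) :
    (data k).vec (inr (inl l)) = ![1, ((l : ℕ) : ℝ), ((l : ℕ) : ℝ) ^ 2] := by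
  ext a
  fin_cases a <;> simp [ConvexFanData.vec, data, gen, planeGen, intVec]

theorem vec_north : (data k).vec (inr (inr north)) = ![0, 1, 0] := by
  ext a
  fin_cases a <;> simp [ConvexFanData.vec, data, gen, planeGen, intVec]

theorem vec_west : (data k).vec (inr (inr west)) = ![-1, 0, 0] := by
  ext a
  fin_cases a <;> simp [ConvexFanData.vec, data, gen, planeGen, intVec]

theorem vec_south : (data k).vec (inr (inr south)) = -(data k).vec (inr (inr north)) := by
  ext a
  fin_cases a <;> simp [ConvexFanData.vec, data, gen, planeGen, intVec]

theorem sum_smul_vec (c : Ray k → ℝ) : ∑ i, c i • (data k).vec i =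
    ![∑ l, c (inr (inl l)) - c (inr (inr west)),
      ∑ l, c (inr (inl l)) * (l : ℕ) + c (inr (inr north)) - c (inr (inr south)),
      ∑ l, c (inr (inl l)) * (l : ℕ) ^ 2 + c (inl true) - c (inl false)] := by
  have hside (f : Side → Fin 3 → ℝ) : ∑ s, f s = f north + (f west + f south) := by
    rw [show (Finset.univ : Finset Side) = {north, west, south} from rfl,
      Finset.sum_insert (by decide), Finset.sum_pair (by decide)]
  simp only [Fintype.sum_sum_type, Fintype.sum_bool, hside, vec_up, vec_down, vec_slope, vec_north,
    vec_west, vec_south]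
  ext a
  simp only [Pi.add_apply, Finset.sum_apply, Pi.smul_apply, Pi.neg_apply, smul_eq_mul]
  fin_cases a <;>
    simp only [Fin.zero_eta, Fin.mk_one, Fin.reduceFinMk, Matrix.cons_val, mul_one] <;>
    ring

theorem sum_mul_sq_eq_zero_iff {c : Fin (k + 1) → ℝ} (hc : 0 ≤ c) :
    ∑ l, c l * (l : ℕ) ^ 2 = 0 ↔ ∑ l, c l * (l : ℕ) = 0 := by
  rw [Finset.sum_eq_zero_iff_of_nonneg fun l _ => mul_nonneg (hc l) (by positivity),
    Finset.sum_eq_zero_iff_of_nonneg fun l _ => mul_nonneg (hc l) (by positivity)]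
  simp

theorem eq_or_eq_of_vec_slope_dotProduct_eq_zero {y : Fin 3 → ℝ} (hy : y 2 ≠ 0)
    {m r : Fin (k + 1)} (hmr : m ≠ r) (hm : (data k).vec (inr (inl m)) ⬝ᵥ y = 0)
    (hr : (data k).vec (inr (inl r)) ⬝ᵥ y = 0) :
    y 1 ≠ 0 ∧ ∀ l, (data k).vec (inr (inl l)) ⬝ᵥ y = 0 → l = m ∨ l = r := by
  have hne : ((m : ℕ) : ℝ) - (r : ℕ) ≠ 0 := sub_ne_zero.2 fun h =>
    hmr (Fin.ext (by exact_mod_cast h))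
  simp only [vec_slope, Matrix.vec3_dotProduct, Matrix.cons_val, one_mul] at hm hr ⊢
  have hsum : y 1 = -(y 2 * ((m : ℕ) + (r : ℕ))) := mul_left_cancel₀ hne (by
    linear_combination hm - hr)
  refine ⟨fun h => ?_, fun l hl => ?_⟩
  · have hadd : ((m : ℕ) : ℝ) + (r : ℕ) = 0 := by simpa [h, hy] using hsum
    have : (m : ℕ) + (r : ℕ) = 0 := by exact_mod_cast hadd
    exact hmr (Fin.ext (by omega))
  · have hprod : (((l : ℕ) : ℝ) - (m : ℕ)) * ((l : ℕ) - (r : ℕ)) = 0 :=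
      mul_left_cancel₀ hy (by linear_combination hl - hm - ((l : ℕ) - (m : ℕ)) * hsum)
    refine (mul_eq_zero.1 hprod).imp ?_ ?_ <;>
      exact fun h => Fin.ext (by exact_mod_cast sub_eq_zero.1 h)

section SlopeCombination

variable {c : Ray k → ℝ} (hc : 0 ≤ c) {m : Fin (k + 1)} (hm : c (inr (inl m)) = 0)
  (hsum : ∑ i, c i • (data k).vec i = (data k).vec (inr (inl m)))
include hc hm hsum

theorem exists_slope_of_sum_smul_vec_eq {y : Fin 3 → ℝ} (hy : y 2 ≠ 0)
    (hvec : ∀ i, c i ≠ 0 → (data k).vec i ⬝ᵥ y = 0) :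
    ∃ r ≠ m, c (inr (inl r)) ≠ 0 ∧ (∀ l ≠ r, c (inr (inl l)) = 0) ∧
      c (inr (inr north)) = 0 ∧ c (inr (inr south)) = 0 := by
  have hm0 : (data k).vec (inr (inl m)) ⬝ᵥ y = 0 := by
    rw [← hsum, ConvexFanData.sum_smul_vec_dotProduct]
    exact Finset.sum_eq_zero fun i _ => mul_eq_zero.2 (or_iff_not_imp_left.2 (hvec i))
  rw [sum_smul_vec, vec_slope] at hsum
  have hx : ∑ l, c (inr (inl l)) - c (inr (inr west)) = 1 := by simpa using congrFun hsum 0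
  obtain ⟨r, -, hr⟩ : ∃ r ∈ Finset.univ, c (inr (inl r)) ≠ 0 :=
    Finset.exists_ne_zero_of_sum_ne_zero (by linarith [show 0 ≤ c (inr (inr west)) from hc _])
  have hrm : r ≠ m := fun h => hr (h ▸ hm)
  obtain ⟨hy1, hslope⟩ := eq_or_eq_of_vec_slope_dotProduct_eq_zero hy hrm.symm hm0 (hvec _ hr)
  refine ⟨r, hrm, hr, fun l hl => by_contra fun h => ?_, by_contra fun h => hy1 ?_,
    by_contra fun h => hy1 ?_⟩
  · exact (hslope l (hvec _ h)).elim (fun hlm => h (hlm ▸ hm)) hl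
  · simpa [vec_north, dotProduct, Fin.sum_univ_three] using hvec _ h
  · simpa [vec_south, vec_north, dotProduct, Fin.sum_univ_three] using hvec _ h

theorem vec_up_mem_span_support :
    (data k).vec (inl true) ∈ Submodule.span ℝ ((data k).vec '' support c) := by
  by_contra hspan
  obtain ⟨hup, hdown⟩ := (data k).eq_zero_of_vec_notMem_span vec_down hspan
  -- A plane without the vertical axis contains at most two vectors on the parabola of slopes.
  obtain ⟨y, hy, hspany⟩ := exists_dotProduct_ne_zero_of_notMem hspan
  obtain ⟨r, hrm, hr, hslope, hnorth, hsouth⟩ := exists_slope_of_sum_smul_vec_eq hc hm hsum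
    (by simpa [vec_up, dotProduct, Fin.sum_univ_three] using hy)
    fun i hi => hspany _ (Submodule.subset_span (Set.mem_image_of_mem _ hi))
  have hsingle (f : Fin (k + 1) → ℝ) : ∑ l, c (inr (inl l)) * f l = c (inr (inl r)) * f r :=
    Fintype.sum_eq_single r fun l hl => by rw [hslope l hl, zero_mul]
  rw [sum_smul_vec, vec_slope] at hsum
  have hlin : c (inr (inl r)) * (r : ℕ) = (m : ℕ) := by
    simpa [hnorth, hsouth, hsingle] using congrFun hsum 1
  have hsq : c (inr (inl r)) * (r : ℕ) ^ 2 = (m : ℕ) ^ 2 := by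
    simpa [hup, hdown, hsingle] using congrFun hsum 2
  have hmul : ((m : ℕ) : ℝ) * ((r : ℕ) - (m : ℕ)) = 0 := by
    linear_combination hsq - ((r : ℕ) : ℝ) * hlin
  refine hrm (Fin.ext ?_)
  rcases mul_eq_zero.1 hmul with hm0 | hrm0
  · have hr0 : ((r : ℕ) : ℝ) = 0 := (mul_eq_zero.1 (hlin.trans hm0)).resolve_left hr
    exact_mod_cast hr0.trans hm0.symm
  · exact_mod_cast sub_eq_zero.1 hrm0

end SlopeCombination

section Coarsening

variable {𝒩 : PolyhedralFan 3} (href : (data k).fan.Refines 𝒩) (hsal : 𝒩.IsSalient)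
include href hsal

theorem cone_slope_mem (m : Fin (k + 1)) : (data k).cone {inr (inl m)} ∈ 𝒩.cones := by
  by_contra hj
  obtain ⟨c, hc, hcj, hsum, hle⟩ :=
    ConvexFanData.exists_combination_of_cone_singleton_notMem href hsal hj
  have hcell (b) : inr (inl m) ∈ (data k).cell (b, inl m) ∧ inl b ∈ (data k).cell (b, inl m) := by
    simp [data, cell]
  exact ConvexFanData.vec_notMem_span_of_vec_eq_neg href hsal hc hsum hle (hcell true).1
    (hcell true).2 (hcell false).1 (hcell false).2 vec_down (vec_up_mem_span_support hc hcj hsum)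

theorem cone_pole_mem (b : Bool) : (data k).cone {inl b} ∈ 𝒩.cones := by
  by_contra hj
  obtain ⟨c, hc, hcj, hsum, hle⟩ :=
    ConvexFanData.exists_combination_of_cone_singleton_notMem href hsal hj
  have hcell (j) : inl b ∈ (data k).cell (b, j) ∧ inr j ∈ (data k).cell (b, j) := by
    simp [data, cell]
  obtain ⟨hnorth, hsouth⟩ := (data k).eq_zero_of_vec_notMem_span vec_south <|
    ConvexFanData.vec_notMem_span_of_vec_eq_neg href hsal hc hsum hle (hcell (inr north)).1
      (hcell (inr north)).2 (hcell (inr south)).1 (hcell (inr south)).2 vec_south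
  rw [sum_smul_vec] at hsum
  have hlin : ∑ l, c (inr (inl l)) * (l : ℕ) = 0 := by
    cases b <;> simpa [vec_down, vec_up, hnorth, hsouth] using congrFun hsum 1
  have hsq := (sum_mul_sq_eq_zero_iff fun l => hc (inr (inl l))).2 hlin
  cases b
  · have h : c (inl true) = -1 := by simpa [vec_down, vec_up, hsq, hcj] using congrFun hsum 2
    linarith [show 0 ≤ c (inl true) from hc _]
  · have h : -c (inl false) = 1 := by simpa [vec_up, hsq, hcj] using congrFun hsum 2
    linarith [show 0 ≤ c (inl false) from hc _]

theorem cone_side_mem (s : Side) : (data k).cone {inr (inr s)} ∈ 𝒩.cones := by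
  by_contra hj
  obtain ⟨c, hc, hcj, hsum, hle⟩ :=
    ConvexFanData.exists_combination_of_cone_singleton_notMem href hsal hj
  have hcell (b) :
      inr (inr s) ∈ (data k).cell (b, inr s) ∧ inl b ∈ (data k).cell (b, inr s) := by
    simp [data, cell]
  obtain ⟨hup, hdown⟩ := (data k).eq_zero_of_vec_notMem_span vec_down <|
    ConvexFanData.vec_notMem_span_of_vec_eq_neg href hsal hc hsum hle (hcell true).1
      (hcell true).2 (hcell false).1 (hcell false).2 vec_down
  rw [sum_smul_vec] at hsum
  have hsq : ∑ l, c (inr (inl l)) * (l : ℕ) ^ 2 = 0 := by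
    cases s <;> simpa [vec_north, vec_west, vec_south, hup, hdown] using congrFun hsum 2
  have hlin := (sum_mul_sq_eq_zero_iff fun l => hc (inr (inl l))).1 hsq
  cases s
  · have h : -c (inr (inr south)) = 1 := by simpa [vec_north, hlin, hcj] using congrFun hsum 1
    linarith [show 0 ≤ c (inr (inr south)) from hc _]
  · have h : ∑ l, c (inr (inl l)) = -1 := by simpa [vec_west, hcj] using congrFun hsum 0
    linarith [show 0 ≤ ∑ l, c (inr (inl l)) from Finset.sum_nonneg fun l _ => hc _]
  · have h : c (inr (inr north)) = -1 := by
      simpa [vec_south, vec_north, hlin, hcj] using congrFun hsum 1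
    linarith [show 0 ≤ c (inr (inr north)) from hc _]

theorem cone_singleton_mem : ∀ j, (data k).cone {j} ∈ 𝒩.cones
  | inl b => cone_pole_mem href hsal b
  | inr (inl m) => cone_slope_mem href hsal m
  | inr (inr s) => cone_side_mem href hsal s

end Coarsening

end SlopeFan

theorem mainTheorem5_general :
    (∀ k : ℕ, ∃ 𝒩 : PolyhedralFan 3,
      𝒩.IsComplete ∧ 𝒩.IsUnimodular ∧ 𝒩.IsPolytopal ∧ 𝒩.rays.ncard = k + 6 ∧
        ∀ 𝒩' : PolyhedralFan 3, 𝒩'.IsSimplicial → ¬ 𝒩.ProperlyRefines 𝒩') ∧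
    ¬ ∃ N : ℕ, ∀ 𝒩 : PolyhedralFan 3,
      𝒩.IsComplete → 𝒩.IsUnimodular → 𝒩.IsPolytopal →
        ∃ 𝒩' : PolyhedralFan 3, 𝒩'.IsSalient ∧ 𝒩'.rays.ncard ≤ N ∧ 𝒩.Refines 𝒩' := by
  refine ⟨fun k => ?_, ?_⟩
  · let D := SlopeFan.data k
    refine ⟨D.fan, D.isComplete_fan, D.isUnimodular_fan, D.isPolytopal_fan,
      D.ncard_rays_fan.trans SlopeFan.card_ray, fun 𝒩' hsimp ⟨href, hne⟩ => hne ?_⟩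
    exact ConvexFanData.fan_eq_of_isSimplicial href hsimp
      (SlopeFan.cone_singleton_mem href hsimp.isSalient)
  · rintro ⟨N, hN⟩
    let D := SlopeFan.data N
    obtain ⟨𝒩', hsal, hcard, href⟩ :=
      hN D.fan D.isComplete_fan D.isUnimodular_fan D.isPolytopal_fan
    have hrays := ConvexFanData.card_le_ncard_rays (SlopeFan.cone_singleton_mem href hsal)
    rw [SlopeFan.card_ray] at hrays
    omega

theorem mainTheorem5 :
    (∀ k : ℕ, ∃ 𝒩 : PolyhedralFan 3,
      𝒩.IsComplete ∧ 𝒩.IsUnimodular ∧ 𝒩.IsPolytopal ∧ 𝒩.rays.ncard = k + 6 ∧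
        ∀ 𝒩' : PolyhedralFan 3, 𝒩'.IsUnimodular → ¬ 𝒩.ProperlyRefines 𝒩') ∧
    ¬ ∃ N : ℕ, ∀ 𝒩 : PolyhedralFan 3,
      𝒩.IsComplete → 𝒩.IsUnimodular → 𝒩.IsPolytopal →
        ∃ 𝒩' : PolyhedralFan 3, 𝒩'.IsUnimodular ∧ 𝒩'.rays.ncard ≤ N ∧ 𝒩.Refines 𝒩' :=
  ⟨fun k => (mainTheorem5_general.1 k).imp fun _ ⟨hcomp, huni, hpoly, hcard, hmin⟩ =>
      ⟨hcomp, huni, hpoly, hcard, fun 𝒩' h => hmin 𝒩' h.isSimplicial⟩,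
    fun ⟨N, hN⟩ => mainTheorem5_general.2 ⟨N, fun 𝒩 hcomp huni hpoly =>
      (hN 𝒩 hcomp huni hpoly).imp fun _ h => ⟨h.1.isSimplicial.isSalient, h.2⟩⟩⟩
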